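/- Let $\mathbb{R}_{\max}=\mathbb{R}\cup\{-\infty\}$ be the max-plus semiring, with addition $a\oplus b=\max(a,b)$ and multiplication $ab=a+b$ (usual sum). Let $p\ge 1$, let $v^1,\dots,v^p\in\mathbb{R}^n$ be vectors with finite entries, and let $\mathscr{V}\subset\mathbb{R}_{\max}^n$ be the max-plus cone they generate, i.e. the smallest subset of $\mathbb{R}_{\max}^n$ that contains $v^1,\dots,v^p$ and contains $\lambda u\oplus\mu w$ for all $u,w$ in it and all $\lambda,\mu\in\mathbb{R}_{\max}$. A half-space with apex $c\in\mathbb{R}^n$ is a set of the form $$\Big\{x\in\mathbb{R}_{\max}^n : \max_{i\in I}(x_i-c_i)\le\max_{j\in J}(x_j-c_j)\Big\},$$ where $I,J$ are disjoint with $I\cup J=\{1,\dots,n\}$ (and $\max\emptyset=-\infty$). The type of $x\in\mathbb{R}^n$ is the tuple $(S_1(x),\dots,S_n(x))$ with $S_j(x)=\{r : v^r_j-x_j=\max_{1\le k\le n}(v^r_k-x_k)\}$. The natural cell decomposition (Develin–Sturmfels) induced by $v^1,\dots,v^p$ is the collection of the sets $X_S=\{x\in\mathbb{R}^n : S_j\subset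 S_j(x)\text{ for all }j\}$, where $S=(S_1,\dots,S_n)$ ranges over the types of the vectors of $\mathbb{R}^n$; each $X_S$ is a convex polyhedron. A vertex of this decomposition is a vector $x\in\mathbb{R}^n$ that belongs to a cell $X_S$ of dimension one. Then: 1. For every $y\in\mathbb{R}_{\max}^n$ with $y\notin\mathscr{V}$ there is a half-space that contains $\mathscr{V}$ but not $y$ and whose apex is a vertex of the natural cell decomposition induced by $v^1,\dots,v^p$. 2. Consequently, $\mathscr{V}$ is the intersection of finitely many half-spaces whose apices are vertices of the natural cell decomposition. -/

import Mathlib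

namespace TropicalCone

/-- The max-plus semiring `ℝ ∪ {-∞}`: its addition is `⊔` (the maximum), its multiplication is
the usual `+` (with `⊥ + x = ⊥`), its zero is `⊥ = -∞` and its unit is the real number `0`. -/
abbrev Rmax : Type := WithBot ℝ

/-- A vector with finite entries, seen in `Rmax ^ n`. -/
def toRmax {n : ℕ} (x : Fin n → ℝ) : Fin n → Rmax := fun i => (x i : Rmax)

/-- The max-plus linear combination `l u ⊕ m w`. -/
def lincomb {n : ℕ} (l m : Rmax) (u w : Fin n → Rmax) : Fin n → Rmax :=
  fun i => (l + u i) ⊔ (m + w i)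

/-- A max-plus cone: a set stable by max-plus linear combinations. -/
def IsMaxPlusCone {n : ℕ} (V : Set (Fin n → Rmax)) : Prop :=
  ∀ u ∈ V, ∀ w ∈ V, ∀ l m : Rmax, lincomb l m u w ∈ V

/-- `cone X`: the smallest max-plus cone containing `X`. -/
def cone {n : ℕ} (X : Set (Fin n → Rmax)) : Set (Fin n → Rmax) :=
  ⋂₀ {V | IsMaxPlusCone V ∧ X ⊆ V}

/-- The max-plus cone generated by the vectors with finite entries `v 0, …, v (p - 1)`. -/
def generatedCone {n p : ℕ} (v : Fin p → Fin n → ℝ) : Set (Fin n → Rmax) :=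
  cone (Set.range fun r => toRmax (v r))

/-- The half-space `{x | ⊕_{i ∈ I} a_i x_i ≤ ⊕_{j ∈ J} a_j x_j}` of `Rmax ^ n`
(an empty max-plus sum is `-∞`). -/
def halfSpace {n : ℕ} (a : Fin n → ℝ) (I J : Finset (Fin n)) : Set (Fin n → Rmax) :=
  {x | I.sup (fun i => (a i : Rmax) + x i) ≤ J.sup (fun j => (a j : Rmax) + x j)}

/-- `H` is a half-space with apex `c`: with `a = -c`, it is
`{x | ⊕_{i ∈ I} a_i x_i ≤ ⊕_{j ∈ J} a_j x_j}` for some partition of the coordinates into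
`I` and `J`. -/
def IsHalfSpaceWithApex {n : ℕ} (H : Set (Fin n → Rmax)) (c : Fin n → ℝ) : Prop :=
  ∃ I J : Finset (Fin n), Disjoint I J ∧ I ∪ J = Finset.univ ∧ H = halfSpace (-c) I J

/-- The type of `x` relative to the generators `v`: the tuple `(S_1(x), …, S_n(x))` where `S_j(x)`
is the set of those `r` for which the maximum of `v^r_k - x_k` over `k` is attained at `k = j`. -/
def typeOf {n p : ℕ} (v : Fin p → Fin n → ℝ) (x : Fin n → ℝ) : Fin n → Set (Fin p) :=
  fun j => {r | ∀ k, v r k - x k ≤ v r j - x j}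

/-- The set `X_S` of the vectors with finite entries whose type contains `S`. -/
def cell {n p : ℕ} (v : Fin p → Fin n → ℝ) (S : Fin n → Set (Fin p)) : Set (Fin n → ℝ) :=
  {x | ∀ j, S j ⊆ typeOf v x j}

/-- The natural cell decomposition induced by the generators `v`: the collection of the sets
`X_S`, where `S` ranges over the types of vectors. -/
def naturalCells {n p : ℕ} (v : Fin p → Fin n → ℝ) : Set (Set (Fin n → ℝ)) :=
  {X | ∃ z : Fin n → ℝ, X = cell v (typeOf v z)}

/-- The dimension of a (convex) subset of `ℝ ^ n`: the dimension of its affine span. -/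
noncomputable def dimension {n : ℕ} (X : Set (Fin n → ℝ)) : ℕ :=
  Module.finrank ℝ (vectorSpan ℝ X)

/-- A vertex of the natural cell decomposition: a vector (with finite entries) in a cell of
dimension one. Cells are stable by translation along `(1, …, 1)`, so that a cell of dimension one
is a single point of the tropical projective space `ℝ ^ n / (1, …, 1) ℝ`. -/
def IsVertex {n p : ℕ} (v : Fin p → Fin n → ℝ) (x : Fin n → ℝ) : Prop :=
  ∃ X ∈ naturalCells v, dimension X = 1 ∧ x ∈ X

end TropicalCone

/-!
A half-space with apex `c` and right-hand side `J` contains the cone of `v 0, …, v (p - 1)` as soon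
as, for every `r`, the maximum of `v r k - c k` over `k` is attained at some `k ∈ J`, that is, `r`
lies in `S_j(c)` for some `j ∈ J`. It excludes `y` if some finite coordinate `i` satisfies
`y j - c j < y i - c i` for all `j ∈ J`.

If `y` is not in the cone, it is dominated by a finite vector `z` that is not in the cone either and
agrees with `y` at a suitable coordinate `i` (`exists_finite_above`). The projection `c` of `z` onto
the cone satisfies `c i < z i`, and together with the set `J` of the coordinates where `z ≤ c` it
has both properties; moreover, all the `S_k(c)` are nonempty (`exists_apex_of_separated`). The
apex is then pushed to a vertex without changing `i` and `J`. The set of the `x` in the cell of `c`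
with `x i = c i` is closed under pointwise suprema, and bounded above because no `S_k(c)` is empty,
so it has a greatest element `e`. Both properties pass from `c` to `e`: types only grow inside the
cell of `c`, and `e ≥ c` with equality at `i`. Finally `e` is a vertex (`isVertex_of_isGreatest`):
otherwise the coordinates would split into two nonempty classes such that no `r` is in both an
`S_j(e)` and an `S_k(e)` with `j`, `k` in different classes, and all the coordinates in the class
that does not contain `i` could be increased a little inside the cell of `c`.

For the second assertion, take all the half-spaces that contain the cone and have a vertex as
apex. They are finitely many: there are finitely many types, a cell of dimension one is a line of
direction `(1, …, 1)`, and a half-space does not change when its apex is translated along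
`(1, …, 1)` (`finite_halfSpaces_vertex`).
-/

namespace TropicalCone

variable {n p : ℕ}

/-! ### Max-plus cones and half-spaces -/

theorem add_finset_sup {ι : Type*} (l : Rmax) (s : Finset ι) (f : ι → Rmax) :
    l + s.sup f = s.sup fun i => l + f i :=
  Finset.apply_sup_eq_sup_comp_of_linearOrder (fun x => l + x)
    (fun _ _ h => add_le_add_right h l) (WithBot.add_bot l)

theorem isMaxPlusCone_halfSpace (a : Fin n → ℝ) (I J : Finset (Fin n)) :
    IsMaxPlusCone (halfSpace a I J) := by
  intro u hu w hw l m
  have key : ∀ s : Finset (Fin n), s.sup (fun i => (a i : Rmax) + lincomb l m u w i) =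
      (l + s.sup fun i => (a i : Rmax) + u i) ⊔ (m + s.sup fun i => (a i : Rmax) + w i) := by
    intro s
    rw [add_finset_sup, add_finset_sup, ← Finset.sup_sup]
    congr 1
    funext i
    simp only [lincomb, Pi.sup_apply, add_max]
    rw [add_left_comm, add_left_comm (a i : Rmax) m]
  simp only [halfSpace, Set.mem_ofPred_eq] at hu hw ⊢
  rw [key, key]
  exact sup_le_sup (add_le_add_right hu l) (add_le_add_right hw m)

theorem generatedCone_subset_halfSpace (v : Fin p → Fin n → ℝ) {c : Fin n → ℝ}
    {I J : Finset (Fin n)} (h : ∀ r, ∃ j ∈ J, r ∈ typeOf v c j) :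
    generatedCone v ⊆ halfSpace (-c) I J := by
  refine Set.sInter_subset_of_mem ⟨isMaxPlusCone_halfSpace _ _ _, ?_⟩
  rintro _ ⟨r, rfl⟩
  obtain ⟨j, hj, hr⟩ := h r
  refine Finset.sup_le fun i _ => le_trans ?_
    (Finset.le_sup (f := fun j => (((-c) j : ℝ) : Rmax) + toRmax (v r) j) hj)
  have := hr i
  simp only [toRmax, Pi.neg_apply]
  norm_cast
  linarith

theorem notMem_halfSpace {c z : Fin n → ℝ} {y : Fin n → Rmax} {I J : Finset (Fin n)} {i : Fin n}
    (hi : i ∈ I) (hyz : ∀ j, y j ≤ z j) (hyi : y i = z i) (h : ∀ j ∈ J, z j - c j < z i - c i) :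
    y ∉ halfSpace (-c) I J := by
  intro hy
  have h1 : ((z i - c i : ℝ) : Rmax) ≤ J.sup fun j => (((-c) j : ℝ) : Rmax) + y j := by
    refine le_trans (le_of_eq ?_)
      ((Finset.le_sup (f := fun j => (((-c) j : ℝ) : Rmax) + y j) hi).trans hy)
    rw [hyi]
    simp only [Pi.neg_apply]
    norm_cast
    ring
  refine absurd h1 (not_le.2 ((Finset.sup_lt_iff (WithBot.bot_lt_coe _)).2 fun j hj => ?_))
  refine lt_of_le_of_lt (add_le_add_right (hyz j) _) ?_
  have := h j hj
  simp only [Pi.neg_apply]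
  norm_cast
  linarith

theorem IsMaxPlusCone.finset_sup_mem {V : Set (Fin n → Rmax)} (hV : IsMaxPlusCone V)
    (hne : V.Nonempty) {ι : Type*} (s : Finset ι) (f : ι → Fin n → Rmax) (hf : ∀ i ∈ s, f i ∈ V) :
    s.sup f ∈ V := by
  classical
  induction s using Finset.induction_on with
  | empty =>
    obtain ⟨u, hu⟩ := hne
    have := hV u hu u hu ⊥ ⊥
    convert this using 1
    funext i
    simp [lincomb]
  | insert a s _ ih =>
    have := hV _ (hf a (Finset.mem_insert_self a s)) _
      (ih fun i hi => hf i (Finset.mem_insert_of_mem hi)) 0 0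
    convert this using 1
    funext i
    simp [lincomb]

/-- A vector `y` lies in the cone as soon as each of its finite coordinates is reached by a
multiple of a generator that is bounded above by `y`. -/
theorem mem_generatedCone (hp : 1 ≤ p) (v : Fin p → Fin n → ℝ) (y : Fin n → Rmax)
    (h : ∀ i, ∀ t : ℝ, y i = t → ∃ r, ∀ j, ((t - v r i + v r j : ℝ) : Rmax) ≤ y j) :
    y ∈ generatedCone v := by
  rintro V ⟨hV, hvV⟩
  have hv : ∀ r, toRmax (v r) ∈ V := fun r => hvV ⟨r, rfl⟩
  have hterm : ∀ i, ∃ u ∈ V, u ≤ y ∧ u i = y i := by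
    intro i
    by_cases hyi : y i = ⊥
    · have r : Fin p := ⟨0, hp⟩
      refine ⟨_, hV _ (hv r) _ (hv r) ⊥ ⊥, fun j => ?_, ?_⟩ <;> simp [lincomb, hyi]
    · obtain ⟨t, ht⟩ := WithBot.ne_bot_iff_exists.1 hyi
      obtain ⟨r, hr⟩ := h i t ht.symm
      refine ⟨_, hV _ (hv r) _ (hv r) ((t - v r i : ℝ) : Rmax) ⊥, fun j => ?_, ?_⟩
      · simpa [lincomb, toRmax] using hr j
      · rw [← ht]
        simp only [lincomb, toRmax, WithBot.bot_add, bot_le, sup_of_le_left]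
        norm_cast
        ring
  choose u huV huy hui using hterm
  have hy : y = Finset.univ.sup u := by
    refine le_antisymm (fun i => ?_) (Finset.sup_le fun i _ => huy i)
    rw [← hui i]
    exact Finset.le_sup (f := u) (Finset.mem_univ i) i
  rw [hy]
  exact hV.finset_sup_mem ⟨_, hv ⟨0, hp⟩⟩ _ _ fun i _ => huV i

/-! ### A separating half-space -/

/-- A vector outside the cone is dominated by a finite vector `z` that agrees with it at a
coordinate `i` which no multiple of a generator below `z` reaches. -/
theorem exists_finite_above (hp : 1 ≤ p) (v : Fin p → Fin n → ℝ) {y : Fin n → Rmax}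
    (hy : y ∉ generatedCone v) :
    ∃ (z : Fin n → ℝ) (i : Fin n), (∀ j, y j ≤ z j) ∧ y i = z i ∧
      ∀ r, ∃ j, z j - v r j < z i - v r i := by
  have hex : ∃ i, ∃ t : ℝ, y i = t ∧ ∀ r, ∃ j, y j < ((t - v r i + v r j : ℝ) : Rmax) := by
    by_contra! hcon
    exact hy (mem_generatedCone hp v y hcon)
  obtain ⟨i, t, hit, hr⟩ := hex
  have r₀ : Fin p := ⟨0, hp⟩
  have hne : (Finset.univ : Finset (Fin p)).Nonempty := ⟨r₀, Finset.mem_univ _⟩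
  -- An infinite coordinate is replaced by a real number so small that it still obstructs every `r`.
  refine ⟨fun j => (y j).unbotD (Finset.univ.inf' hne (fun r => t - v r i + v r j) - 1), i,
    fun j => ?_, ?_, fun r => ?_⟩
  · cases hyj : y j using WithBot.recBotCoe with
    | bot => exact bot_le
    | coe s => simp [hyj]
  · simp [hit]
  · obtain ⟨j, hj⟩ := hr r
    refine ⟨j, ?_⟩
    simp only [hit, WithBot.unbotD_coe]
    cases hyj : y j using WithBot.recBotCoe with
    | bot =>
      have := Finset.inf'_le (fun r => t - v r i + v r j) (Finset.mem_univ r)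
      simp only [WithBot.unbotD_bot]
      linarith
    | coe s =>
      rw [hyj] at hj
      have := WithBot.coe_lt_coe.1 hj
      simp only [WithBot.unbotD_coe]
      linarith

/-- The apex is the projection of `z` onto the cone, the greatest max-plus combination of the
generators below `z`. -/
theorem exists_apex_of_separated (hp : 1 ≤ p) (v : Fin p → Fin n → ℝ) {z : Fin n → ℝ} {i : Fin n}
    (h : ∀ r, ∃ j, z j - v r j < z i - v r i) :
    ∃ c : Fin n → ℝ, c i < z i ∧ (∀ k, (typeOf v c k).Nonempty) ∧
      ∀ r, ∃ j, z j ≤ c j ∧ r ∈ typeOf v c j := by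
  have hmin : ∀ r, ∃ j, ∀ k, z j - v r j ≤ z k - v r k := fun r =>
    haveI : Nonempty (Fin n) := ⟨i⟩
    Finite.exists_min fun j => z j - v r j
  choose m hm using hmin
  have hmax : ∀ k, ∃ r, ∀ s, v s k + (z (m s) - v s (m s)) ≤ v r k + (z (m r) - v r (m r)) :=
    fun k =>
    haveI : Nonempty (Fin p) := ⟨⟨0, hp⟩⟩
    Finite.exists_max fun s => v s k + (z (m s) - v s (m s))
  choose q hq using hmax
  refine ⟨fun k => v (q k) k + (z (m (q k)) - v (q k) (m (q k))), ?_, fun k => ⟨q k, fun l => ?_⟩,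
    fun r => ⟨m r, ?_, fun l => ?_⟩⟩
  · obtain ⟨j, hj⟩ := h (q i)
    have := hm (q i) j
    linarith
  · have := hq l (q k)
    linarith
  · have := hq (m r) r
    linarith
  · have h1 := hq l r
    have h2 := hm (q (m r)) (m r)
    dsimp only
    linarith

/-! ### Vertices -/

theorem mem_cell_typeOf (v : Fin p → Fin n → ℝ) (x : Fin n → ℝ) : x ∈ cell v (typeOf v x) :=
  fun _ => subset_rfl

theorem add_const_mem_cell {v : Fin p → Fin n → ℝ} {S : Fin n → Set (Fin p)} {x : Fin n → ℝ}
    (hx : x ∈ cell v S) (t : ℝ) : x + (fun _ => t) ∈ cell v S := by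
  intro j r hr k
  have := hx j hr k
  simp only [Pi.add_apply]
  linarith

theorem one_mem_vectorSpan_cell {v : Fin p → Fin n → ℝ} {S : Fin n → Set (Fin p)} {x : Fin n → ℝ}
    (hx : x ∈ cell v S) : (1 : Fin n → ℝ) ∈ vectorSpan ℝ (cell v S) := by
  have := vsub_mem_vectorSpan ℝ (add_const_mem_cell hx 1) hx
  convert this using 1
  simp [Pi.one_def]

theorem isVertex_of_cell_typeOf [Nonempty (Fin n)] {v : Fin p → Fin n → ℝ} {e : Fin n → ℝ}
    (h : ∀ x ∈ cell v (typeOf v e), ∃ t : ℝ, ∀ k, x k = e k + t) : IsVertex v e := by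
  refine ⟨_, ⟨e, rfl⟩, ?_, mem_cell_typeOf v e⟩
  have hspan : vectorSpan ℝ (cell v (typeOf v e)) = Submodule.span ℝ {(1 : Fin n → ℝ)} := by
    refine le_antisymm (Submodule.span_le.2 ?_) ?_
    · rintro _ ⟨x, hx, w, hw, rfl⟩
      obtain ⟨s, hs⟩ := h x hx
      obtain ⟨t, ht⟩ := h w hw
      refine Submodule.mem_span_singleton.2 ⟨s - t, ?_⟩
      funext k
      simp [hs, ht]
    · rw [Submodule.span_singleton_le_iff_mem]
      exact one_mem_vectorSpan_cell (mem_cell_typeOf v e)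
  rw [dimension, hspan]
  exact finrank_span_singleton one_ne_zero

/-- The greatest element of the slice `x i = t` of a cell is a vertex. -/
theorem isVertex_of_isGreatest {v : Fin p → Fin n → ℝ} {S : Fin n → Set (Fin p)} {i : Fin n}
    {t : ℝ} {e : Fin n → ℝ} (he : IsGreatest {x | x ∈ cell v S ∧ x i = t} e) : IsVertex v e := by
  obtain ⟨⟨heS, hei⟩, hub⟩ := he
  have : Nonempty (Fin n) := ⟨i⟩
  refine isVertex_of_cell_typeOf fun x hx => ⟨x i - e i, ?_⟩
  by_contra! ⟨k, hk⟩
  -- `C` is the set where `x - e` has the same value as at `i`. If the maximum of `v r - e` is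
  -- attained at two coordinates, then `x - e` agrees at both, since `x` is in the cell of the type
  -- of `e`. Hence that maximum is never attained both in `C` and outside `C`.
  set C : Set (Fin n) := {l | x l = e l + (x i - e i)} with hC
  have hiC : i ∈ C := by simp [hC]
  have hgap : ∀ r, ∀ j ∉ C, r ∈ typeOf v e j → ∀ l ∈ C, v r l - e l < v r j - e j := by
    intro r j hj hrj l hl
    refine lt_of_le_of_ne (hrj l) fun heq => hj ?_
    have hrl : r ∈ typeOf v e l := fun k => (hrj k).trans heq.ge
    have h1 := hx j hrj l
    have h2 := hx l hrl j
    simp only [hC, Set.mem_ofPred_eq] at hl ⊢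
    linarith
  obtain ⟨ε, hε, hεle⟩ : ∃ ε : ℝ, 0 < ε ∧ ∀ r, ∀ j ∉ C, r ∈ typeOf v e j → ∀ l ∈ C,
      ε ≤ (v r j - e j) - (v r l - e l) := by
    have hev : ∀ᶠ ε : ℝ in nhdsWithin 0 (Set.Ioi 0), ∀ r, ∀ j ∉ C, r ∈ typeOf v e j → ∀ l ∈ C,
        ε ≤ (v r j - e j) - (v r l - e l) := by
      simp only [Filter.eventually_all]
      intro r j hj hrj l hl
      exact nhdsWithin_le_nhds (Iic_mem_nhds (sub_pos.2 (hgap r j hj hrj l hl)))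
    obtain ⟨ε, h, hε⟩ := (hev.and self_mem_nhdsWithin).exists
    exact ⟨ε, hε, h⟩
  classical
  have hmem : (fun l => if l ∈ C then e l else e l + ε) ∈ {x | x ∈ cell v S ∧ x i = t} := by
    refine ⟨fun j r hr l => ?_, by simp [hiC, hei]⟩
    have hrj := heS j hr
    have h1 := hrj l
    by_cases hj : j ∈ C <;> by_cases hl : l ∈ C <;> simp only [hj, hl, if_true, if_false]
    · exact h1
    · linarith
    · have := hεle r j hj hrj l hl
      linarith
    · linarith
  have hkC : k ∉ C := hk
  have := hub hmem k
  simp only [hkC, if_false] at this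
  linarith

theorem exists_isGreatest_cell {v : Fin p → Fin n → ℝ} {S : Fin n → Set (Fin p)}
    {c : Fin n → ℝ} (hc : c ∈ cell v S) (hS : ∀ k, (S k).Nonempty) (i : Fin n) :
    ∃ e, IsGreatest {x | x ∈ cell v S ∧ x i = c i} e := by
  set K : Set (Fin n → ℝ) := {x | x ∈ cell v S ∧ x i = c i} with hK
  have hcK : c ∈ K := ⟨hc, rfl⟩
  have hbdd : BddAbove K := by
    choose r hr using hS
    refine ⟨fun k => c i + (v (r k) k - v (r k) i), fun x hx k => ?_⟩
    have h1 := hx.1 k (hr k) i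
    have h2 := hx.2
    linarith
  have hlub : IsLUB K (sSup K) := isLUB_csSup ⟨c, hcK⟩ hbdd
  have hlub' := isLUB_pi.1 hlub
  refine ⟨sSup K, ⟨fun j r hr k => ?_, ?_⟩, hlub.1⟩
  · have : sSup K j ≤ sSup K k + (v r j - v r k) := by
      refine (hlub' j).2 ?_
      rintro _ ⟨x, hx, rfl⟩
      have h1 := hx.1 j hr k
      have h2 := hlub.1 hx k
      simp only [Function.eval]
      linarith
    linarith
  · refine le_antisymm ((hlub' i).2 ?_) (hlub.1 hcK i)
    rintro _ ⟨x, hx, rfl⟩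
    exact hx.2.le

theorem exists_halfSpace_separating (hp : 1 ≤ p) (v : Fin p → Fin n → ℝ) {y : Fin n → Rmax}
    (hy : y ∉ generatedCone v) :
    ∃ (H : Set (Fin n → Rmax)) (c : Fin n → ℝ),
      IsHalfSpaceWithApex H c ∧ IsVertex v c ∧ generatedCone v ⊆ H ∧ y ∉ H := by
  obtain ⟨z, i, hyz, hyi, hz⟩ := exists_finite_above hp v hy
  obtain ⟨c, hci, hne, hcov⟩ := exists_apex_of_separated hp v hz
  obtain ⟨e, he⟩ := exists_isGreatest_cell (mem_cell_typeOf v c) hne i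
  have hce : c ≤ e := he.2 ⟨mem_cell_typeOf v c, rfl⟩
  have hei : e i = c i := he.1.2
  set J : Finset (Fin n) := Finset.univ.filter fun j => z j ≤ c j with hJ
  refine ⟨halfSpace (-e) Jᶜ J, e, ⟨Jᶜ, J, disjoint_compl_left, ?_, rfl⟩,
    isVertex_of_isGreatest he, generatedCone_subset_halfSpace v fun r => ?_,
    notMem_halfSpace (i := i) ?_ hyz hyi fun j hj => ?_⟩
  · ext k
    by_cases hk : k ∈ J <;> simp [hk]
  · obtain ⟨j, hj, hr⟩ := hcov r
    exact ⟨j, by simpa [hJ] using hj, he.1.1 j hr⟩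
  · simpa [hJ] using hci
  · have h1 : z j ≤ c j := by simpa [hJ] using hj
    have h2 := hce j
    linarith

/-! ### Finiteness -/

theorem halfSpace_add_const_subset (c : Fin n → ℝ) (t : ℝ) (I J : Finset (Fin n)) :
    halfSpace (-(c + fun _ => t)) I J ⊆ halfSpace (-c) I J := by
  intro x hx
  have key : ∀ s : Finset (Fin n), s.sup (fun i => (((-c) i : ℝ) : Rmax) + x i) =
      (t : Rmax) + s.sup fun i => ((-(c + fun _ => t) : Fin n → ℝ) i : Rmax) + x i := by
    intro s
    rw [add_finset_sup]
    congr 1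
    funext i
    rw [← add_assoc, ← WithBot.coe_add]
    simp
  simp only [halfSpace, Set.mem_ofPred_eq] at hx ⊢
  rw [key, key]
  exact add_le_add_right hx _

theorem exists_add_const_of_dimension_eq_one {v : Fin p → Fin n → ℝ} {S : Fin n → Set (Fin p)}
    (h : dimension (cell v S) = 1) {c e : Fin n → ℝ} (hc : c ∈ cell v S) (he : e ∈ cell v S) :
    ∃ t : ℝ, e = c + fun _ => t := by
  rcases isEmpty_or_nonempty (Fin n) with hn | hn
  · exact ⟨0, Subsingleton.elim _ _⟩
  have h1 : (⟨1, one_mem_vectorSpan_cell hc⟩ : vectorSpan ℝ (cell v S)) ≠ 0 := fun h0 =>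
    one_ne_zero (congrArg Subtype.val h0)
  obtain ⟨t, ht⟩ := (finrank_eq_one_iff_of_nonzero' _ h1).1 h
    ⟨e -ᵥ c, vsub_mem_vectorSpan ℝ he hc⟩
  refine ⟨t, funext fun k => ?_⟩
  have := congrFun (congrArg Subtype.val ht) k
  simp at this
  simp [this]

theorem finite_halfSpaces_vertex (v : Fin p → Fin n → ℝ) :
    {H : Set (Fin n → Rmax) | ∃ c, IsHalfSpaceWithApex H c ∧ IsVertex v c}.Finite := by
  refine (Set.finite_iUnion (ι := (Fin n → Set (Fin p)) × Finset (Fin n) × Finset (Fin n))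
    (f := fun q => {H | ∃ c ∈ cell v q.1, dimension (cell v q.1) = 1 ∧
      H = halfSpace (-c) q.2.1 q.2.2}) fun q => Set.Subsingleton.finite ?_).subset ?_
  · have hle : ∀ c ∈ cell v q.1, ∀ e ∈ cell v q.1, dimension (cell v q.1) = 1 →
        halfSpace (-e) q.2.1 q.2.2 ⊆ halfSpace (-c) q.2.1 q.2.2 := by
      intro c hc e he hd
      obtain ⟨t, rfl⟩ := exists_add_const_of_dimension_eq_one hd hc he
      exact halfSpace_add_const_subset c t _ _
    rintro _ ⟨c, hc, hd, rfl⟩ _ ⟨e, he, -, rfl⟩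
    exact (hle e he c hc hd).antisymm (hle c hc e he hd)
  · rintro _ ⟨c, ⟨I, J, -, -, rfl⟩, _, ⟨x, rfl⟩, hd, hc⟩
    exact Set.mem_iUnion.2 ⟨(typeOf v x, I, J), c, hc, hd, rfl⟩

end TropicalCone

theorem proposition4p5 {n p : ℕ} (hp : 1 ≤ p) (v : Fin p → Fin n → ℝ) :
    (∀ y : Fin n → TropicalCone.Rmax, y ∉ TropicalCone.generatedCone v →
      ∃ (H : Set (Fin n → TropicalCone.Rmax)) (c : Fin n → ℝ),
        TropicalCone.IsHalfSpaceWithApex H c ∧ TropicalCone.IsVertex v c ∧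
        TropicalCone.generatedCone v ⊆ H ∧ y ∉ H) ∧
    (∃ F : Set (Set (Fin n → TropicalCone.Rmax)), F.Finite ∧
      (∀ H ∈ F, ∃ c : Fin n → ℝ,
        TropicalCone.IsHalfSpaceWithApex H c ∧ TropicalCone.IsVertex v c) ∧
      TropicalCone.generatedCone v = ⋂₀ F) := by
  refine ⟨fun y hy => TropicalCone.exists_halfSpace_separating hp v hy,
    {H | (∃ c, TropicalCone.IsHalfSpaceWithApex H c ∧ TropicalCone.IsVertex v c) ∧
      TropicalCone.generatedCone v ⊆ H},
    (TropicalCone.finite_halfSpaces_vertex v).subset fun H hH => hH.1, fun H hH => hH.1,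
    Set.Subset.antisymm (Set.subset_sInter fun H hH => hH.2) fun y hy => ?_⟩
  by_contra hcon
  obtain ⟨H, c, hHc, hc, hsub, hyH⟩ := TropicalCone.exists_halfSpace_separating hp v hcon
  exact hyH (hy H ⟨⟨c, hHc, hc⟩, hsub⟩)
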